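/- Let $V$ be a real vector space of dimension $N\ge 2$ with a Lorentzian metric $g_{ab}$ of signature $(+,-,\dots,-)$ (a tangent space of a Lorentzian manifold); indices are raised with $g$. For a $p$-form $\Omega$ write $\Omega\cdot\Omega=\Omega_{a_1\dots a_p}\Omega^{a_1\dots a_p}$ and, for $p\ge1$, $(\Omega\odot\Omega)_{ab}=\frac{(-1)^{p-1}}{(p-1)!}\,\Omega_{ac_2\dots c_p}\Omega_b{}^{c_2\dots c_p}$. The superenergy tensor of $\Omega$ is $T_{ab}\{\Omega\}=\frac12\big(\Omega\odot\Omega+{*\Omega}\odot{*\Omega}\big)_{ab}$ for $1\le p\le N-1$, where $*$ is the Hodge dual, and $T_{ab}\{\Omega\}=\frac12 h^2g_{ab}$ for an $N$-form $\Omega=h\eta$, where $\eta$ is the canonical volume form. A $p$-form is simple if it is the exterior product of $p$ linearly independent 1-forms, and null if it is simple and $\Omega\cdot\Omega=0$. Let $\mathcal{SS}$ (respectively $\mathcal{NS}$) be the set of superenergy tensors of simple (respectively null) $p$-forms, $1\le p\le N$, and let $-\mathcal{SS}$, $-\mathcal{NS}$ be the sets of their negatives. A 1-form $k$ is null if $k\ne0$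 and $k_ak^a=0$, and causal if $k\neq 0$ and $k_ak^a\ge0$. Say that a simple $p$-form is of causal type if it is a causal 1-form when $p=1$, and an exterior product of $p$ linearly independent null 1-forms when $p\ge2$. Theorem. Let $T_{ab}$ be a symmetric tensor with $(T\times T)_{ab}:=T_{ac}T_b{}^c=f\,g_{ab}$ for a real number $f$; if $N=2$, assume also $f\ge0$. Then: (a) If $f=0$, then $T_{ab}=\beta k_ak_b$ for some real $\beta$ and some null $k$, and, if $T\ne0$, then $T\in\mathcal{NS}\cup-\mathcal{NS}$. (b) If $f\ne0$, then $f>0$ and there is a sign $\epsilon=\pm1$ with $\epsilon T\in\mathcal{SS}$ and $\epsilon T_a{}^a=(2p-N)\sqrt f$ for some $p\in\{1,\dots,N\}$. Moreover, for this $\epsilon$ and for every $p\in\{1,\dots,N\}$, one has $\epsilon T_a{}^a=(2p-N)\sqrt f$ if and only if $\epsilon T_{ab}=T_{ab}\{\Omega\}$ for some simple $p$-form $\Omega$ of causal type. -/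

import Mathlib

namespace SuperEnergy

open Module

variable {V : Type*} [AddCommGroup V] [Module ℝ V] {N : ℕ}

/-- The diagonal entries of the Minkowski metric, signature `(+, -, …, -)`. -/
def sgn (i : Fin N) : ℝ := if (i : ℕ) = 0 then 1 else -1

/-- `e` is an orthonormal frame of the bilinear form `g` with signature `(+, -, …, -)`.
A Lorentzian metric on an `N`-dimensional space is a form which has such a frame. -/
def IsOrthonormalFrame (g : LinearMap.BilinForm ℝ V) (e : Basis (Fin N) ℝ V) : Prop :=
  ∀ i j, g (e i) (e j) = if i = j then sgn i else 0

/-! Below, `e` is an orthonormal frame of the metric.  In it the inverse metric has the components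
`g^{ij} = sgn i * δ^{ij}`, so that contracting a pair of indices amounts to inserting `e i` in both
places and summing over `i` with the weight `sgn i`. -/

/-- The trace `T_a^a`. -/
noncomputable def metricTrace (e : Basis (Fin N) ℝ V) (T : LinearMap.BilinForm ℝ V) : ℝ :=
  ∑ i, sgn i * T (e i) (e i)

/-- The product `(S × T)_{ab} = S_{ac} T_b^c` of symmetric tensors. -/
noncomputable def cross (e : Basis (Fin N) ℝ V) (S T : LinearMap.BilinForm ℝ V) (u v : V) : ℝ :=
  ∑ i, sgn i * S u (e i) * T v (e i)

/-- The scalar product `α_a β^a` of 1-forms. -/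
noncomputable def dot (e : Basis (Fin N) ℝ V) (α β : Dual ℝ V) : ℝ :=
  ∑ i, sgn i * α (e i) * β (e i)

/-- A null 1-form: non-zero, with vanishing square. -/
def IsNull (e : Basis (Fin N) ℝ V) (k : Dual ℝ V) : Prop :=
  k ≠ 0 ∧ dot e k k = 0

/-- The full contraction `Ω ⬝ Ω' = Ω_{a₁…a_p} Ω'^{a₁…a_p}` of two `p`-forms. -/
noncomputable def formDot (e : Basis (Fin N) ℝ V) {p : ℕ} (Ω Ω' : V [⋀^Fin p]→ₗ[ℝ] ℝ) : ℝ :=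
  ∑ I : Fin p → Fin N,
    (∏ k, sgn (I k)) * Ω (fun k => e (I k)) * Ω' (fun k => e (I k))

/-- The product
`(Ω ⊙ Ω)_{ab} = ((-1)^(p-1) / (p-1)!) Ω_{a c₂…c_p} Ω_b^{c₂…c_p}` for a `p`-form, `p ≥ 1`
(with the value `0`, which is never used, for `p = 0`). -/
noncomputable def odot (e : Basis (Fin N) ℝ V) :
    {p : ℕ} → V [⋀^Fin p]→ₗ[ℝ] ℝ → V → V → ℝ
  | 0, _, _, _ => 0
  | q + 1, Ω, u, v =>
    (-1 : ℝ) ^ q / (q.factorial : ℝ) *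
      ∑ I : Fin q → Fin N, (∏ k, sgn (I k)) *
        Ω (Fin.cons u fun k => e (I k)) * Ω (Fin.cons v fun k => e (I k))

/-- The `m`-form `v ↦ η(a₁, …, a_p, v₁, …, v_m)`, where `p + m = N` and `η = e.det` is the
canonical volume form of the orthonormal frame. -/
noncomputable def volumeInsert (e : Basis (Fin N) ℝ V) {p m : ℕ} (h : p + m = N)
    (a : Fin p → V) : V [⋀^Fin m]→ₗ[ℝ] ℝ where
  toFun v := e.det fun i => Fin.append a v (Fin.cast h.symm i)
  map_update_add' := by
    intro _ v i x y
    subst h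
    have key : ∀ z : V, Fin.append a (Function.update v i z) =
        Function.update (Fin.append a v) (Fin.natAdd p i) z := by
      intro z
      funext j
      refine Fin.addCases (fun j => ?_) (fun j => ?_) j
      · rw [Function.update_of_ne (by
          intro hj
          have := congrArg Fin.val hj
          simp at this
          omega)]
        simp
      · by_cases hj : j = i
        · subst hj; simp
        · rw [Function.update_of_ne (by simpa using hj)]
          simp [hj]
    have : ‹DecidableEq (Fin m)› = instDecidableEqFin m := Subsingleton.elim _ _
    subst this
    simp only [Fin.cast_eq_self, key]
    exact e.det.map_update_add _ _ _ _
  map_update_smul' := by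
    intro _ v i c x
    subst h
    have key : ∀ z : V, Fin.append a (Function.update v i z) =
        Function.update (Fin.append a v) (Fin.natAdd p i) z := by
      intro z
      funext j
      refine Fin.addCases (fun j => ?_) (fun j => ?_) j
      · rw [Function.update_of_ne (by
          intro hj
          have := congrArg Fin.val hj
          simp at this
          omega)]
        simp
      · by_cases hj : j = i
        · subst hj; simp
        · rw [Function.update_of_ne (by simpa using hj)]
          simp [hj]
    have : ‹DecidableEq (Fin m)› = instDecidableEqFin m := Subsingleton.elim _ _
    subst this
    simp only [Fin.cast_eq_self, key]
    exact e.det.map_update_smul _ _ _ _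
  map_eq_zero_of_eq' := by
    intro v i j hv hij
    subst h
    refine e.det.map_eq_zero_of_eq (i := Fin.natAdd p i) (j := Fin.natAdd p j) _ ?_ ?_
    · simpa using hv
    · simpa using hij

/-- The Hodge dual `(*Ω)_{b₁…b_m} = (1/p!) η_{a₁…a_p b₁…b_m} Ω^{a₁…a_p}` of a `p`-form,
where `m = N - p`. -/
noncomputable def hodgeDual (e : Basis (Fin N) ℝ V) {p m : ℕ} (h : p + m = N)
    (Ω : V [⋀^Fin p]→ₗ[ℝ] ℝ) : V [⋀^Fin m]→ₗ[ℝ] ℝ :=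
  (1 / (p.factorial : ℝ)) • ∑ I : Fin p → Fin N,
    ((∏ k, sgn (I k)) * Ω (fun k => e (I k))) • volumeInsert e h (fun k => e (I k))

/-- The superenergy tensor `T_{ab}{Ω}` of a `p`-form, `1 ≤ p ≤ N`: half the sum of `Ω ⊙ Ω` and
`*Ω ⊙ *Ω` if `p < N`, and `(1/2) f² g_{ab}` for the `N`-form `Ω = f η`. -/
noncomputable def superenergy (g : LinearMap.BilinForm ℝ V) (e : Basis (Fin N) ℝ V) {p : ℕ}
    (Ω : V [⋀^Fin p]→ₗ[ℝ] ℝ) (u v : V) : ℝ :=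
  if h : p < N then
    1 / 2 * (odot e Ω u v + odot e (hodgeDual e (Nat.add_sub_of_le h.le) Ω) u v)
  else if h : p = N then
    1 / 2 * (Ω fun i => e (Fin.cast h i)) ^ 2 * g u v
  else 0

/-- The `p`-form `ω¹ ∧ … ∧ ω^p`, `(v₁, …, v_p) ↦ det (ω^j (v_i))`. -/
noncomputable def wedge {p : ℕ} (ω : Fin p → Dual ℝ V) : V [⋀^Fin p]→ₗ[ℝ] ℝ :=
  (Matrix.detRowAlternating (n := Fin p) (R := ℝ)).compLinearMap (LinearMap.pi ω)

/-- A simple `p`-form: the exterior product of `p` linearly independent 1-forms. -/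
def IsSimple {p : ℕ} (Ω : V [⋀^Fin p]→ₗ[ℝ] ℝ) : Prop :=
  ∃ ω : Fin p → Dual ℝ V, LinearIndependent ℝ ω ∧ Ω = wedge ω

/-- A null `p`-form: simple, with `Ω ⬝ Ω = 0`. -/
def IsNullForm (e : Basis (Fin N) ℝ V) {p : ℕ} (Ω : V [⋀^Fin p]→ₗ[ℝ] ℝ) : Prop :=
  IsSimple Ω ∧ formDot e Ω Ω = 0

/-- A simple `p`-form of causal type: a causal 1-form if `p = 1`, and the exterior product of
`p` (linearly independent) null 1-forms if `p > 1`. -/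
def IsCausalSimple (e : Basis (Fin N) ℝ V) {p : ℕ} (Ω : V [⋀^Fin p]→ₗ[ℝ] ℝ) : Prop :=
  ∃ ω : Fin p → Dual ℝ V, LinearIndependent ℝ ω ∧ Ω = wedge ω ∧
    (p = 1 → ∀ i, 0 ≤ dot e (ω i) (ω i)) ∧ (1 < p → ∀ i, IsNull e (ω i))

/-- The set of superenergy tensors of simple `p`-forms, `1 ≤ p ≤ N`. -/
def SS (g : LinearMap.BilinForm ℝ V) (e : Basis (Fin N) ℝ V) : Set (LinearMap.BilinForm ℝ V) :=
  {T | ∃ p : ℕ, 1 ≤ p ∧ p ≤ N ∧ ∃ Ω : V [⋀^Fin p]→ₗ[ℝ] ℝ,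
    IsSimple Ω ∧ ∀ u v, T u v = superenergy g e Ω u v}

/-- The set of superenergy tensors of null `p`-forms, `1 ≤ p ≤ N`. -/
def NS (g : LinearMap.BilinForm ℝ V) (e : Basis (Fin N) ℝ V) : Set (LinearMap.BilinForm ℝ V) :=
  {T | ∃ p : ℕ, 1 ≤ p ∧ p ≤ N ∧ ∃ Ω : V [⋀^Fin p]→ₗ[ℝ] ℝ,
    IsNullForm e Ω ∧ ∀ u v, T u v = superenergy g e Ω u v}

end SuperEnergy

/-!
Put `λ = ((-1)^(p-1) / (2 p!)) Ω ⬝ Ω`. The identity `*Ω ⊙ *Ω = Ω ⊙ Ω - 2 λ g` gives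
`T{Ω} = Ω ⊙ Ω - λ g`. For `Ω = ω¹ ∧ … ∧ ω^p` and `W` the span of the vectors `ω^j` with raised
indices, `g(u, ·) ∧ Ω = 0` for `u ∈ W` and `Ω` vanishes on `W^⊥`, so `T{Ω}` is `λ g` on `W` and
`-λ g` on `W^⊥`. Conversely, if `T × T = r² g` with `r > 0`, the endomorphism `T_a^b` squares to
`r²`, and after a choice of sign its `r`-eigenspace `W` contains a timelike vector; such a `W` is
spanned by null vectors (or by one timelike vector), whose exterior product is the required form.
If `T × T = 0`, the vectors `T_a^b u^a` are null and mutually orthogonal, hence proportional.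
-/

namespace SuperEnergy

open Module

section ExteriorMultiplication

variable {R M E : Type*} [CommRing R] [AddCommGroup M] [Module R M] [AddCommGroup E] [Module R E]

/-- The exterior product `α ∧ Ω` of a 1-form and a `p`-form, bilinear in both. The normalisation is
`(α ∧ Ω) (v₀, …, v_p) = ∑ i, (-1)^i α (v_i) Ω (v₀, …, v̂_i, …, v_p)`. -/
def extMul {p : ℕ} : Dual R M →ₗ[R] M [⋀^Fin p]→ₗ[R] E →ₗ[R] M [⋀^Fin (p + 1)]→ₗ[R] E :=
  LinearMap.smulRightₗ.compr₂ AlternatingMap.alternatizeUncurryFinLM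

lemma extMul_apply {p : ℕ} (α : Dual R M) (Ω : M [⋀^Fin p]→ₗ[R] E) (v : Fin (p + 1) → M) :
    extMul α Ω v = ∑ i : Fin (p + 1), (-1) ^ (i : ℕ) • α (v i) • Ω (i.removeNth v) := by
  simp [extMul, AlternatingMap.alternatizeUncurryFin_apply]

lemma curryLeft_extMul_zero (α : Dual R M) (Ω : M [⋀^Fin 0]→ₗ[R] E) (u : M) :
    (extMul α Ω).curryLeft u = α u • Ω := by
  ext v
  simp [extMul_apply, Fin.removeNth_zero, Matrix.vecCons, Fin.tail_cons]

lemma curryLeft_extMul {p : ℕ} (α : Dual R M) (Ω : M [⋀^Fin (p + 1)]→ₗ[R] E) (u : M) :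
    (extMul α Ω).curryLeft u = α u • Ω - extMul α (Ω.curryLeft u) := by
  ext v
  have removeNth_succ (i : Fin (p + 1)) :
      i.succ.removeNth (Matrix.vecCons u v) = Matrix.vecCons u (i.removeNth v) := by
    ext j; cases j using Fin.cases <;> simp [Fin.removeNth]
  simp [extMul_apply, Fin.sum_univ_succ (n := p + 1), pow_succ, removeNth_succ,
    ← Finset.sum_neg_distrib, sub_eq_add_neg]

lemma curryLeft_curryLeft_comm {p : ℕ} (Ω : M [⋀^Fin (p + 2)]→ₗ[R] E) (u v : M) :
    (Ω.curryLeft u).curryLeft v = -(Ω.curryLeft v).curryLeft u := by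
  rw [eq_neg_iff_add_eq_zero]
  simpa using (Ω.curryLeft_same (u + v))

end ExteriorMultiplication

variable {V : Type*} [AddCommGroup V] [Module ℝ V] {N : ℕ}
  {g : LinearMap.BilinForm ℝ V} {e : Basis (Fin N) ℝ V}

lemma sgn_mul_self (i : Fin N) : sgn i * sgn i = 1 := by
  unfold sgn; split_ifs <;> norm_num

lemma prod_sgn_mul_self {ι : Type*} [Fintype ι] (I : ι → Fin N) :
    (∏ k, sgn (I k)) * ∏ k, sgn (I k) = 1 := by
  simp [← Finset.prod_mul_distrib, sgn_mul_self]

section Frame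

namespace IsOrthonormalFrame

lemma apply_left (he : IsOrthonormalFrame g e) (x : V) (i : Fin N) :
    g x (e i) = e.repr x i * sgn i := by
  conv_lhs => rw [← e.sum_repr x]
  simp only [map_sum, LinearMap.sum_apply, map_smul, LinearMap.smul_apply, smul_eq_mul, he _ _,
    mul_ite, mul_zero, Finset.sum_ite_eq', Finset.mem_univ, if_true]

lemma sum_sgn_smul (he : IsOrthonormalFrame g e) (x : V) :
    ∑ i, (sgn i * g x (e i)) • e i = x := by
  conv_rhs => rw [← e.sum_repr x]
  refine Finset.sum_congr rfl fun i _ => ?_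
  rw [he.apply_left, mul_comm (sgn i), mul_assoc, sgn_mul_self, mul_one]

lemma symm (he : IsOrthonormalFrame g e) (x y : V) : g x y = g y x := by
  have : g = g.flip := e.ext fun i => e.ext fun j => by
    change g (e i) (e j) = g (e j) (e i)
    rw [he, he]
    split_ifs with hij hji hji
    exacts [congrArg sgn hij, absurd hij.symm hji, absurd hji.symm hij, rfl]
  conv_lhs => rw [this]
  rfl

lemma eq_zero (he : IsOrthonormalFrame g e) {x : V} (h : ∀ y, g x y = 0) : x = 0 := by
  rw [← he.sum_sgn_smul x]; simp [h]

end IsOrthonormalFrame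

/-- The vector obtained from a 1-form by raising the index. Lowering the index of a vector `x`
gives the 1-form `g x`. -/
noncomputable def sharp (e : Basis (Fin N) ℝ V) : Dual ℝ V →ₗ[ℝ] V where
  toFun α := ∑ i, (sgn i * α (e i)) • e i
  map_add' α β := by simp [mul_add, add_smul, Finset.sum_add_distrib]
  map_smul' c α := by simp [Finset.smul_sum, smul_smul, mul_left_comm]

lemma map_sharp {M : Type*} [AddCommGroup M] [Module ℝ M] (F : V →ₗ[ℝ] M) (α : Dual ℝ V) :
    F (sharp e α) = ∑ i, (sgn i * α (e i)) • F (e i) := by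
  simp [sharp]

lemma apply_sharp (α β : Dual ℝ V) : β (sharp e α) = dot e α β := by
  simp [map_sharp, dot]

namespace IsOrthonormalFrame

lemma sharp_flat (he : IsOrthonormalFrame g e) (x : V) : sharp e (g x) = x :=
  he.sum_sgn_smul x

lemma flat_sharp (he : IsOrthonormalFrame g e) (α : Dual ℝ V) : g (sharp e α) = α :=
  e.ext fun i => by
    rw [he.apply_left, sharp, LinearMap.coe_mk, AddHom.coe_mk, e.repr_sum_self, mul_right_comm,
      sgn_mul_self, one_mul]

lemma dot_flat (he : IsOrthonormalFrame g e) (x y : V) : dot e (g x) (g y) = g x y := by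
  rw [← apply_sharp, he.sharp_flat, he.symm]

lemma apply_sharp_sharp (he : IsOrthonormalFrame g e) (α β : Dual ℝ V) :
    g (sharp e α) (sharp e β) = dot e α β := by
  rw [he.symm, he.flat_sharp, apply_sharp]

lemma sharp_injective (he : IsOrthonormalFrame g e) : Function.Injective (sharp e) :=
  Function.LeftInverse.injective he.flat_sharp

end IsOrthonormalFrame

end Frame

section FormDot

/-- The scalar product `formDot` of `p`-forms as a bilinear form. -/
noncomputable def formInner (e : Basis (Fin N) ℝ V) (p : ℕ) :
    LinearMap.BilinForm ℝ (V [⋀^Fin p]→ₗ[ℝ] ℝ) :=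
  LinearMap.mk₂ ℝ (formDot e)
    (fun _ _ _ => by simp [formDot, mul_add, add_mul, Finset.sum_add_distrib])
    (fun _ _ _ => by simp [formDot, Finset.mul_sum, mul_left_comm, mul_assoc])
    (fun _ _ _ => by simp [formDot, mul_add, Finset.sum_add_distrib])
    (fun _ _ _ => by simp [formDot, Finset.mul_sum, mul_left_comm])

lemma formInner_apply {p : ℕ} (Ω Ψ : V [⋀^Fin p]→ₗ[ℝ] ℝ) : formInner e p Ω Ψ = formDot e Ω Ψ :=
  rfl

lemma formInner_comm {p : ℕ} (Ω Ψ : V [⋀^Fin p]→ₗ[ℝ] ℝ) :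
    formInner e p Ω Ψ = formInner e p Ψ Ω := by
  simp only [formInner_apply, formDot, mul_right_comm]

lemma formInner_zero (Ω Ψ : V [⋀^Fin 0]→ₗ[ℝ] ℝ) :
    formInner e 0 Ω Ψ = Ω ![] * Ψ ![] := by
  simp [formInner_apply, formDot, Subsingleton.elim _ ![]]

lemma formInner_succ {p : ℕ} (Ω Ψ : V [⋀^Fin (p + 1)]→ₗ[ℝ] ℝ) :
    formInner e (p + 1) Ω Ψ =
      ∑ i, sgn i * formInner e p (Ω.curryLeft (e i)) (Ψ.curryLeft (e i)) := by
  have apply_cons (i : Fin N) (J : Fin p → Fin N) :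
      (fun k => e ((Fin.cons i J : Fin (p + 1) → Fin N) k)) =
        Matrix.vecCons (e i) fun k => e (J k) := by
    ext k; cases k using Fin.cases <;> simp
  simp only [formInner_apply, formDot, ← (Fin.consEquiv fun _ => Fin N).sum_comp,
    Fintype.sum_prod_type, Fin.consEquiv_apply, Fin.prod_univ_succ, Fin.cons_zero, Fin.cons_succ,
    apply_cons, AlternatingMap.curryLeft_apply_apply, Finset.mul_sum, mul_assoc]

lemma odot_succ {q : ℕ} (Ω : V [⋀^Fin (q + 1)]→ₗ[ℝ] ℝ) (u v : V) :
    odot e Ω u v = (-1) ^ q / q.factorial * formInner e q (Ω.curryLeft u) (Ω.curryLeft v) :=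
  rfl

lemma sum_sgn_mul_formInner_curryLeft {p : ℕ} (α : Dual ℝ V) (Ω : V [⋀^Fin p]→ₗ[ℝ] ℝ)
    (Ψ : V [⋀^Fin (p + 1)]→ₗ[ℝ] ℝ) :
    ∑ i, sgn i * (α (e i) * formInner e p Ω (Ψ.curryLeft (e i))) =
      formInner e p Ω (Ψ.curryLeft (sharp e α)) := by
  rw [map_sharp, map_sum]
  simp [mul_assoc]

lemma formInner_extMul {p : ℕ} (α : Dual ℝ V) (Ω : V [⋀^Fin p]→ₗ[ℝ] ℝ)
    (Ψ : V [⋀^Fin (p + 1)]→ₗ[ℝ] ℝ) :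
    formInner e (p + 1) (extMul α Ω) Ψ = (p + 1) * formInner e p Ω (Ψ.curryLeft (sharp e α)) := by
  induction p with
  | zero =>
    simp only [formInner_succ, curryLeft_extMul_zero, map_smul, LinearMap.smul_apply, smul_eq_mul,
      sum_sgn_mul_formInner_curryLeft]
    simp
  | succ p ih =>
    have contract_sharp (i : Fin N) :
        formInner e (p + 1) (extMul α (Ω.curryLeft (e i))) (Ψ.curryLeft (e i)) =
          -((p + 1) * formInner e p (Ω.curryLeft (e i))
            ((Ψ.curryLeft (sharp e α)).curryLeft (e i))) := by
      rw [ih, curryLeft_curryLeft_comm, map_neg, mul_neg]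
    rw [formInner_succ]
    simp only [curryLeft_extMul, map_sub, LinearMap.sub_apply, map_smul, LinearMap.smul_apply,
      smul_eq_mul, contract_sharp, mul_sub, Finset.sum_sub_distrib,
      sum_sgn_mul_formInner_curryLeft]
    rw [formInner_succ Ω]
    simp only [mul_neg, Finset.sum_neg_distrib, mul_left_comm (sgn _) ((p : ℝ) + 1),
      ← Finset.mul_sum]
    push_cast
    ring

lemma formInner_extMul_extMul {p : ℕ} (α β : Dual ℝ V) (Ω Ψ : V [⋀^Fin (p + 1)]→ₗ[ℝ] ℝ) :
    formInner e (p + 2) (extMul α Ω) (extMul β Ψ) =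
      (p + 2) * (dot e α β * formInner e (p + 1) Ω Ψ -
        (p + 1) * formInner e p (Ω.curryLeft (sharp e β)) (Ψ.curryLeft (sharp e α))) := by
  rw [formInner_extMul, curryLeft_extMul, map_sub, map_smul, smul_eq_mul, apply_sharp,
    formInner_comm Ω (extMul β _), formInner_extMul, formInner_comm (Ψ.curryLeft _)]
  push_cast
  ring

lemma sum_sgn_mul_formInner_extMul (he : IsOrthonormalFrame g e) {p : ℕ}
    (Ω Ψ : V [⋀^Fin p]→ₗ[ℝ] ℝ) :
    ∑ i, sgn i * formInner e (p + 1) (extMul (g (e i)) Ω) (extMul (g (e i)) Ψ) =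
      (p + 1) * (N - p) * formInner e p Ω Ψ := by
  have dot_frame (i : Fin N) : dot e (g (e i)) (g (e i)) = sgn i := by
    rw [he.dot_flat, he, if_pos rfl]
  cases p with
  | zero =>
    have term (i : Fin N) :
        sgn i * formInner e 1 (extMul (g (e i)) Ω) (extMul (g (e i)) Ψ) = formInner e 0 Ω Ψ := by
      rw [formInner_extMul, curryLeft_extMul_zero, apply_sharp, dot_frame, map_smul, smul_eq_mul,
        Nat.cast_zero, zero_add, one_mul, ← mul_assoc, sgn_mul_self, one_mul]
    simp [term]
  | succ p =>
    simp only [formInner_extMul_extMul, he.sharp_flat, dot_frame, mul_left_comm (sgn _),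
      ← Finset.mul_sum, mul_sub, Finset.sum_sub_distrib, ← formInner_succ, ← mul_assoc (sgn _),
      sgn_mul_self, one_mul, Finset.sum_const, Finset.card_univ, Fintype.card_fin, nsmul_eq_mul]
    push_cast
    ring

end FormDot

section HodgeDual

lemma formInner_top (Ω Ψ : V [⋀^Fin N]→ₗ[ℝ] ℝ) :
    formInner e N Ω Ψ = N.factorial * (∏ i : Fin N, sgn i) * (Ω e * Ψ e) := by
  classical
  have term_perm (σ : Equiv.Perm (Fin N)) :
      (∏ k, sgn (σ k)) * Ω (fun k => e (σ k)) * Ψ (fun k => e (σ k)) =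
        (∏ i : Fin N, sgn i) * (Ω e * Ψ e) := by
    have sign_sq : ((Equiv.Perm.sign σ : ℤ) : ℝ) * (Equiv.Perm.sign σ : ℤ) = 1 := by
      rw [← Int.cast_mul, ← Units.val_mul, Int.units_mul_self, Units.val_one, Int.cast_one]
    have hΩ := Ω.map_perm e σ
    have hΨ := Ψ.map_perm e σ
    rw [Units.smul_def, zsmul_eq_mul] at hΩ hΨ
    rw [show (fun k => e (σ k)) = e ∘ σ from rfl, hΩ, hΨ, Equiv.prod_comp σ]
    linear_combination (∏ i : Fin N, sgn i) * Ω e * Ψ e * sign_sq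
  calc formInner e N Ω Ψ
    _ = ∑ σ : Equiv.Perm (Fin N),
          (∏ k, sgn (σ k)) * Ω (fun k => e (σ k)) * Ψ (fun k => e (σ k)) := by
      refine (Finset.sum_of_injOn (fun σ : Equiv.Perm (Fin N) => ⇑σ)
        DFunLike.coe_injective.injOn (by simp) (fun I _ hI => ?_) fun _ _ => rfl).symm
      rw [Ω.map_eq_zero_of_not_injective (fun k => e (I k)), mul_zero, zero_mul]
      intro hinj
      exact hI ⟨Equiv.ofBijective I (Finite.injective_iff_bijective.mp hinj.of_comp), by simp⟩
    _ = ∑ _σ : Equiv.Perm (Fin N), (∏ i : Fin N, sgn i) * (Ω e * Ψ e) :=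
      Finset.sum_congr rfl fun σ _ => term_perm σ
    _ = N.factorial * (∏ i : Fin N, sgn i) * (Ω e * Ψ e) := by
      simp [Fintype.card_perm, mul_assoc]

lemma extMul_top_eq_zero (α : Dual ℝ V) (e : Basis (Fin N) ℝ V) (Ω : V [⋀^Fin N]→ₗ[ℝ] ℝ) :
    extMul α Ω = 0 := by
  refine Basis.ext_alternating e fun I hI => ?_
  simpa using Fintype.card_le_of_injective I hI

lemma exists_volumeInsert_eq {p m : ℕ} (h : p + m = N) (v : Fin m → V) :
    ∃ Ψ : V [⋀^Fin p]→ₗ[ℝ] ℝ, ∀ a, volumeInsert e h a v = Ψ a := by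
  have h' : m + p = N := by omega
  let σ : Equiv.Perm (Fin N) := (finCongr h.symm).trans (finAddFlip.trans (finCongr h'))
  refine ⟨(Equiv.Perm.sign σ : ℤ) • volumeInsert e h' v, fun a => ?_⟩
  have append_flip : (fun i => Fin.append a v (Fin.cast h.symm i)) =
      (fun i => Fin.append v a (Fin.cast h'.symm i)) ∘ σ := by
    ext i
    obtain ⟨j, rfl⟩ := (finCongr h).surjective i
    cases j using Fin.addCases <;> simp [σ]
  change e.det (fun i => Fin.append a v (Fin.cast h.symm i)) = _
  rw [append_flip, AlternatingMap.map_perm]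
  rfl

lemma volumeInsert_cons_right {p m : ℕ} (h : p + (m + 1) = N) (h' : p + 1 + m = N)
    (a : Fin p → V) (u : V) (v : Fin m → V) :
    volumeInsert e h a (Matrix.vecCons u v) =
      (-1) ^ p * volumeInsert e h' (Matrix.vecCons u a) v := by
  subst h
  have append_left : (fun i => Fin.append (Matrix.vecCons u a) v (Fin.cast h'.symm i)) =
      (Fin.cons u (Fin.append a v) : Fin (p + m + 1) → V) := by
    ext i
    simp [Matrix.vecCons, Fin.append_cons]
  have append_right : Fin.append a (Matrix.vecCons u v) =
      Fin.insertNth (n := p + m) ⟨p, by omega⟩ u (Fin.append a v) := by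
    refine Fin.eq_insertNth_iff.mpr ⟨?_, ?_⟩
    · exact Fin.append_right a (Matrix.vecCons u v) 0
    · ext j
      cases j using Fin.addCases with
      | left j =>
        have : (⟨p, by omega⟩ : Fin (p + m + 1)).succAbove (Fin.castAdd m j) =
            Fin.castAdd (m + 1) j := Fin.succAbove_of_castSucc_lt _ _ j.isLt
        simp only [Fin.removeNth, this, Fin.append_left]
      | right j =>
        have : (⟨p, by omega⟩ : Fin (p + m + 1)).succAbove (Fin.natAdd p j) =
            Fin.natAdd p j.succ :=
          Fin.succAbove_of_le_castSucc _ _ (Nat.le_add_right p j)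
        simp only [Fin.removeNth, this, Fin.append_right, Matrix.cons_val_succ]
  change e.det (Fin.append a (Matrix.vecCons u v)) = (-1) ^ p * e.det _
  rw [append_left, append_right, AlternatingMap.map_insertNth, zsmul_eq_mul]
  norm_cast

lemma hodgeDual_apply_eq_formInner {p m : ℕ} (h : p + m = N) (Ω : V [⋀^Fin p]→ₗ[ℝ] ℝ)
    {v : Fin m → V} {Ψ : V [⋀^Fin p]→ₗ[ℝ] ℝ} (hΨ : ∀ a, volumeInsert e h a v = Ψ a) :
    hodgeDual e h Ω v = 1 / p.factorial * formInner e p Ω Ψ := by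
  have sum_apply (F : (Fin p → Fin N) → V [⋀^Fin m]→ₗ[ℝ] ℝ) : (∑ I, F I) v = ∑ I, F I v :=
    map_sum (AddMonoidHom.mk' (fun ω : V [⋀^Fin m]→ₗ[ℝ] ℝ => ω v) fun _ _ => rfl) F _
  simp only [hodgeDual, AlternatingMap.smul_apply, sum_apply, hΨ, smul_eq_mul, formInner_apply,
    formDot]

lemma curryLeft_hodgeDual (he : IsOrthonormalFrame g e) {p m : ℕ} (h : p + (m + 1) = N)
    (h' : p + 1 + m = N) (Ω : V [⋀^Fin p]→ₗ[ℝ] ℝ) (u : V) :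
    (hodgeDual e h Ω).curryLeft u = (-1 : ℝ) ^ p • hodgeDual e h' (extMul (g u) Ω) := by
  ext v
  obtain ⟨Ψ, hΨ⟩ := exists_volumeInsert_eq (e := e) h' v
  have insert_cons (a : Fin p → V) :
      volumeInsert e h a (Matrix.vecCons u v) = ((-1 : ℝ) ^ p • Ψ.curryLeft u) a := by
    rw [volumeInsert_cons_right h h', hΨ]; rfl
  rw [AlternatingMap.curryLeft_apply_apply, AlternatingMap.smul_apply,
    hodgeDual_apply_eq_formInner h Ω insert_cons, hodgeDual_apply_eq_formInner h' _ hΨ,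
    formInner_extMul, he.sharp_flat, map_smul, Nat.factorial_succ]
  push_cast
  rw [smul_eq_mul, smul_eq_mul]
  field_simp

lemma formInner_curryLeft_hodgeDual (he : IsOrthonormalFrame g e) {p m : ℕ}
    (h : p + (m + 1) = N) (h' : p + 1 + m = N) (Ω Ψ : V [⋀^Fin p]→ₗ[ℝ] ℝ) (u v : V) :
    formInner e m ((hodgeDual e h Ω).curryLeft u) ((hodgeDual e h Ψ).curryLeft v) =
      formInner e m (hodgeDual e h' (extMul (g u) Ω)) (hodgeDual e h' (extMul (g v) Ψ)) := by
  rw [curryLeft_hodgeDual he h h', curryLeft_hodgeDual he h h', map_smul, map_smul,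
    LinearMap.smul_apply, smul_smul, ← mul_pow, neg_one_mul, neg_neg, one_pow, one_smul]

lemma formInner_hodgeDual (he : IsOrthonormalFrame g e) {p m : ℕ} (h : p + m = N)
    (Ω Ψ : V [⋀^Fin p]→ₗ[ℝ] ℝ) :
    p.factorial * formInner e m (hodgeDual e h Ω) (hodgeDual e h Ψ) =
      m.factorial * (∏ i : Fin N, sgn i) * formInner e p Ω Ψ := by
  induction m generalizing p with
  | zero =>
    have hp : p = N := h
    subst hp
    have hodgeDual_top (Φ : V [⋀^Fin p]→ₗ[ℝ] ℝ) :
        hodgeDual e h Φ ![] = (∏ i : Fin p, sgn i) * Φ e := by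
      have insert_eq (a : Fin p → V) : volumeInsert e h a ![] = e.det a := by
        change e.det _ = e.det a
        congr 1
        ext i
        exact Fin.append_left a ![] i
      rw [hodgeDual_apply_eq_formInner h Φ insert_eq, formInner_top, e.det_self]
      field_simp
    rw [formInner_zero, hodgeDual_top, hodgeDual_top, formInner_top]
    linear_combination p.factorial * (∏ i : Fin p, sgn i) * (Ω e * Ψ e) * prod_sgn_mul_self id
  | succ m ih =>
    have h' : p + 1 + m = N := by omega
    have hN : (N : ℝ) = p + (m + 1) := by exact_mod_cast h.symm
    have contract_hodge (i : Fin N) :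
        p.factorial * formInner e m ((hodgeDual e h Ω).curryLeft (e i))
            ((hodgeDual e h Ψ).curryLeft (e i)) =
          m.factorial * (∏ i : Fin N, sgn i) / (p + 1) *
            formInner e (p + 1) (extMul (g (e i)) Ω) (extMul (g (e i)) Ψ) := by
      have ih := ih h' (extMul (g (e i)) Ω) (extMul (g (e i)) Ψ)
      rw [Nat.factorial_succ, Nat.cast_mul, Nat.cast_succ] at ih
      rw [formInner_curryLeft_hodgeDual he h h', div_mul_eq_mul_div, ← ih]
      field_simp
    rw [formInner_succ, Finset.mul_sum]
    simp only [mul_left_comm (p.factorial : ℝ), contract_hodge, mul_left_comm (sgn _)]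
    rw [← Finset.mul_sum, sum_sgn_mul_formInner_extMul he, hN, Nat.factorial_succ]
    push_cast
    field_simp
    ring

lemma prod_sgn (hN : 1 ≤ N) : ∏ i : Fin N, sgn i = (-1 : ℝ) ^ (N - 1) := by
  obtain ⟨n, rfl⟩ := Nat.exists_eq_add_of_le' hN
  simp [Fin.prod_univ_succ, sgn]

end HodgeDual

section Superenergy

/-- The number `λ = ((-1)^(p-1) / (2 p!)) Ω ⬝ Ω` attached to a `p`-form, for which
`T_{ab}{Ω} = (Ω ⊙ Ω)_{ab} - λ g_{ab}`. The exponent is written `p + 1` to avoid a truncated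
subtraction. -/
noncomputable def halfSquare (e : Basis (Fin N) ℝ V) {p : ℕ} (Ω : V [⋀^Fin p]→ₗ[ℝ] ℝ) : ℝ :=
  (-1) ^ (p + 1) / (2 * p.factorial) * formInner e p Ω Ω

lemma neg_one_pow_mul_self (n : ℕ) : (-1 : ℝ) ^ n * (-1) ^ n = 1 :=
  pow_mul_pow_eq_one n (by norm_num)

lemma halfSquare_top (hN : 1 ≤ N) (Ω : V [⋀^Fin N]→ₗ[ℝ] ℝ) :
    halfSquare e Ω = 1 / 2 * Ω e ^ 2 := by
  obtain ⟨n, rfl⟩ := Nat.exists_eq_add_of_le' hN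
  rw [halfSquare, formInner_top, prod_sgn hN, Nat.add_sub_cancel]
  field_simp
  linear_combination Ω e ^ 2 * neg_one_pow_mul_self n

lemma formInner_extMul_flat (he : IsOrthonormalFrame g e) {p : ℕ} (hp : 1 ≤ p)
    (Ω : V [⋀^Fin p]→ₗ[ℝ] ℝ) (u v : V) :
    formInner e (p + 1) (extMul (g u) Ω) (extMul (g v) Ω) =
      (-1) ^ (p + 1) * (p + 1).factorial * (2 * halfSquare e Ω * g u v - odot e Ω u v) := by
  obtain ⟨q, rfl⟩ := Nat.exists_eq_add_of_le' hp
  rw [formInner_extMul_extMul, he.dot_flat, he.sharp_flat, he.sharp_flat, odot_succ, halfSquare,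
    formInner_comm (Ω.curryLeft v)]
  simp only [Nat.factorial_succ]
  push_cast
  field_simp
  linear_combination -(q + 2) * (formInner e (q + 1) Ω Ω * g u v -
    (q + 1) * formInner e q (Ω.curryLeft u) (Ω.curryLeft v)) * neg_one_pow_mul_self q

lemma odot_hodgeDual (he : IsOrthonormalFrame g e) {p m : ℕ} (h : p + m = N) (hp : 1 ≤ p)
    (hm : 1 ≤ m) (Ω : V [⋀^Fin p]→ₗ[ℝ] ℝ) (u v : V) :
    odot e (hodgeDual e h Ω) u v = odot e Ω u v - 2 * halfSquare e Ω * g u v := by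
  obtain ⟨m, rfl⟩ := Nat.exists_eq_add_of_le' hm
  have h' : p + 1 + m = N := by omega
  have isometry := formInner_hodgeDual he h' (extMul (g u) Ω) (extMul (g v) Ω)
  rw [formInner_extMul_flat he hp, prod_sgn (by omega), show N - 1 = p + m by omega] at isometry
  rw [odot_succ, formInner_curryLeft_hodgeDual he h h']
  set X := formInner e m (hodgeDual e h' (extMul (g u) Ω)) (hodgeDual e h' (extMul (g v) Ω))
  have hX : X = -((-1) ^ m * m.factorial * (2 * halfSquare e Ω * g u v - odot e Ω u v)) := by
    refine mul_left_cancel₀ (Nat.cast_ne_zero.mpr (p + 1).factorial_ne_zero) ?_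
    linear_combination isometry - (p + 1).factorial * (-1) ^ m * m.factorial *
      (2 * halfSquare e Ω * g u v - odot e Ω u v) * neg_one_pow_mul_self p
  rw [hX]
  field_simp
  linear_combination (odot e Ω u v - 2 * halfSquare e Ω * g u v) * neg_one_pow_mul_self m

lemma odot_of_extMul_eq_zero (he : IsOrthonormalFrame g e) {p : ℕ} (hp : 1 ≤ p)
    {Ω : V [⋀^Fin p]→ₗ[ℝ] ℝ} {u : V} (hu : extMul (g u) Ω = 0) (v : V) :
    odot e Ω u v = 2 * halfSquare e Ω * g u v := by
  have clifford := formInner_extMul_flat he hp Ω u v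
  rw [hu, map_zero, LinearMap.zero_apply, zero_eq_mul, or_iff_right (by positivity)] at clifford
  linarith

lemma superenergy_eq (he : IsOrthonormalFrame g e) {p : ℕ} (hp : 1 ≤ p) (hpN : p ≤ N)
    (Ω : V [⋀^Fin p]→ₗ[ℝ] ℝ) (u v : V) :
    superenergy g e Ω u v = odot e Ω u v - halfSquare e Ω * g u v := by
  rcases hpN.lt_or_eq with hlt | rfl
  · rw [superenergy, dif_pos hlt, odot_hodgeDual he _ hp (by omega)]
    ring
  · rw [odot_of_extMul_eq_zero he hp (extMul_top_eq_zero _ e Ω)]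
    rw [superenergy, dif_neg (lt_irrefl p), dif_pos rfl, halfSquare_top hp]
    change 1 / 2 * Ω e ^ 2 * g u v = _
    ring

lemma superenergy_of_extMul_eq_zero (he : IsOrthonormalFrame g e) {p : ℕ} (hp : 1 ≤ p)
    (hpN : p ≤ N) {Ω : V [⋀^Fin p]→ₗ[ℝ] ℝ} {u : V} (hu : extMul (g u) Ω = 0) (v : V) :
    superenergy g e Ω u v = halfSquare e Ω * g u v := by
  rw [superenergy_eq he hp hpN, odot_of_extMul_eq_zero he hp hu]
  ring

lemma superenergy_add_left (he : IsOrthonormalFrame g e) {p : ℕ} (hp : 1 ≤ p) (hpN : p ≤ N)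
    (Ω : V [⋀^Fin p]→ₗ[ℝ] ℝ) (u u' v : V) :
    superenergy g e Ω (u + u') v = superenergy g e Ω u v + superenergy g e Ω u' v := by
  simp only [superenergy_eq he hp hpN]
  obtain ⟨q, rfl⟩ := Nat.exists_eq_add_of_le' hp
  simp only [odot_succ, map_add, LinearMap.add_apply]
  ring

lemma superenergy_comm (he : IsOrthonormalFrame g e) {p : ℕ} (hp : 1 ≤ p) (hpN : p ≤ N)
    (Ω : V [⋀^Fin p]→ₗ[ℝ] ℝ) (u v : V) : superenergy g e Ω u v = superenergy g e Ω v u := by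
  simp only [superenergy_eq he hp hpN]
  obtain ⟨q, rfl⟩ := Nat.exists_eq_add_of_le' hp
  rw [odot_succ, odot_succ, formInner_comm, he.symm u v]

lemma halfSquare_smul {p : ℕ} (c : ℝ) (Ω : V [⋀^Fin p]→ₗ[ℝ] ℝ) :
    halfSquare e (c • Ω) = c ^ 2 * halfSquare e Ω := by
  simp only [halfSquare, map_smul, LinearMap.smul_apply, smul_eq_mul]
  ring

lemma sum_sgn_mul_superenergy (he : IsOrthonormalFrame g e) {p : ℕ} (hp : 1 ≤ p) (hpN : p ≤ N)
    (Ω : V [⋀^Fin p]→ₗ[ℝ] ℝ) :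
    ∑ i, sgn i * superenergy g e Ω (e i) (e i) = (2 * p - N) * halfSquare e Ω := by
  obtain ⟨q, rfl⟩ := Nat.exists_eq_add_of_le' hp
  have trace_metric : ∑ i, sgn i * g (e i) (e i) = N := by
    simp [he _ _, sgn_mul_self]
  have trace_odot : ∑ i, sgn i * odot e Ω (e i) (e i) = 2 * (q + 1) * halfSquare e Ω := by
    simp only [odot_succ, mul_left_comm (sgn _), ← Finset.mul_sum, ← formInner_succ, halfSquare,
      Nat.factorial_succ]
    push_cast
    field_simp
    ring
  simp only [superenergy_eq he hp hpN, mul_sub, Finset.sum_sub_distrib, trace_odot,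
    mul_left_comm (sgn _), ← Finset.mul_sum, trace_metric]
  push_cast
  ring

end Superenergy

section Causality

lemma sum_apply_smul_add_smul {R M ι : Type*} [CommRing R] [AddCommGroup M] [Module R M]
    [Fintype ι] (B : LinearMap.BilinForm R M) {a : R} {x₀ : M} {c : ι → R} {x : ι → M}
    (hcx : ∑ i, c i • x i = -(a • x₀)) :
    ∑ i, B (a • x i + c i • x₀) (a • x i + c i • x₀) =
      a ^ 2 * (∑ i, B (x i) (x i) - 2 * B x₀ x₀) + (∑ i, c i ^ 2) * B x₀ x₀ := by
  have sum_right : ∑ i, c i * B x₀ (x i) = -(a * B x₀ x₀) := by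
    simpa using congrArg (B x₀) hcx
  have sum_left : ∑ i, c i * B (x i) x₀ = -(a * B x₀ x₀) := by
    simpa using congrArg (B.flip x₀) hcx
  calc _ = ∑ i, (a ^ 2 * B (x i) (x i) + a * (c i * B (x i) x₀) + a * (c i * B x₀ (x i)) +
          c i ^ 2 * B x₀ x₀) := by
        refine Finset.sum_congr rfl fun i _ => ?_
        simp only [map_add, map_smul, LinearMap.add_apply, LinearMap.smul_apply, smul_eq_mul]
        ring
    _ = _ := by
        simp only [Finset.sum_add_distrib, ← Finset.mul_sum, ← Finset.sum_mul, sum_left, sum_right]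
        ring

-- Orthogonality to a timelike vector forces negativity, for tuples with entries in a space `S` on
-- which `B` is positive definite: with `S = ℝ` this is the statement for vectors, and with `S` a
-- space of forms it is the induction step in the sign of `Ω ⬝ Ω`.
lemma sum_sgn_mul_apply_self_neg {M : Type*} [AddCommGroup M] [Module ℝ M]
    {B : LinearMap.BilinForm ℝ M} {S : Submodule ℝ M} (hB : ∀ y ∈ S, y ≠ 0 → 0 < B y y)
    {c : Fin N → ℝ} (hc : 0 < ∑ i, sgn i * c i ^ 2) {x : Fin N → M} (hx : ∀ i, x i ∈ S)
    (hcx : ∑ i, c i • x i = 0) (hx0 : x ≠ 0) :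
    ∑ i, sgn i * B (x i) (x i) < 0 := by
  rcases N with _ | n
  · simp at hc
  simp only [Fin.sum_univ_succ, sgn, Fin.val_zero, Fin.val_succ, Nat.add_eq_zero_iff, one_ne_zero,
    and_false, if_true, if_false, one_mul, neg_one_mul, Finset.sum_neg_distrib] at hc hcx ⊢
  have hB' : ∀ y ∈ S, 0 ≤ B y y := fun y hy => by
    rcases eq_or_ne y 0 with rfl | hy0
    exacts [by simp, (hB y hy hy0).le]
  have tail_eq : ∑ i : Fin n, c i.succ • x i.succ = -(c 0 • x 0) :=
    eq_neg_of_add_eq_zero_right hcx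
  have shifted_nonneg :
      0 ≤ ∑ i : Fin n, B (c 0 • x i.succ + c i.succ • x 0) (c 0 • x i.succ + c i.succ • x 0) :=
    Finset.sum_nonneg fun i _ =>
      hB' _ (S.add_mem (S.smul_mem _ (hx _)) (S.smul_mem _ (hx 0)))
  rw [sum_apply_smul_add_smul B tail_eq] at shifted_nonneg
  rcases eq_or_ne (x 0) 0 with h0 | h0
  · obtain ⟨i, hi⟩ : ∃ i : Fin n, x i.succ ≠ 0 := by
      by_contra! h
      exact hx0 (funext fun i => Fin.cases h0 h i)
    have : 0 < ∑ i : Fin n, B (x i.succ) (x i.succ) :=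
      Finset.sum_pos' (fun i _ => hB' _ (hx _)) ⟨i, Finset.mem_univ i, hB _ (hx _) hi⟩
    simpa [h0] using this
  · have := hB _ (hx 0) h0
    have : 0 ≤ ∑ i : Fin n, c i.succ ^ 2 := Finset.sum_nonneg fun i _ => sq_nonneg _
    nlinarith

namespace IsOrthonormalFrame

lemma sum_sgn_mul_sq (he : IsOrthonormalFrame g e) (x : V) :
    ∑ i, sgn i * g x (e i) ^ 2 = g x x := by
  rw [← he.dot_flat, dot]
  simp only [sq, mul_assoc]

lemma apply_self_neg_of_orthogonal (he : IsOrthonormalFrame g e) {t x : V} (ht : 0 < g t t)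
    (hxt : g x t = 0) (hx : x ≠ 0) : g x x < 0 := by
  have neg := sum_sgn_mul_apply_self_neg (B := LinearMap.mul ℝ ℝ) (S := ⊤)
    (c := fun i => sgn i * g t (e i)) (x := fun i => g x (e i))
    (fun y _ hy => mul_self_pos.mpr hy)
    (by simpa [mul_pow, pow_two (sgn _), sgn_mul_self, he.sum_sgn_mul_sq] using ht)
    (fun _ => trivial)
    (by simpa [dot, mul_assoc] using (he.dot_flat t x).trans ((he.symm t x).trans hxt))
    (fun h => hx <| by rw [← he.sum_sgn_smul x]; simp [congrFun h _])
  simpa [← sq, he.sum_sgn_mul_sq] using neg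

lemma exists_apply_self_pos (he : IsOrthonormalFrame g e) (hN : 1 ≤ N) :
    ∃ t, 0 < g t t :=
  ⟨e ⟨0, hN⟩, by simp [he _ _, sgn]⟩

lemma eq_zero_of_orthogonal (he : IsOrthonormalFrame g e) {t x : V} (ht : 0 < g t t)
    (hxt : g x t = 0) (hx : 0 ≤ g x x) : x = 0 := by
  by_contra h
  exact hx.not_gt (he.apply_self_neg_of_orthogonal ht hxt h)

lemma smul_eq_smul_of_null (he : IsOrthonormalFrame g e) {t a b : V} (ht : 0 < g t t)
    (ha : g a a = 0) (hb : g b b = 0) (hab : g a b = 0) : g b t • a = g a t • b := by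
  rw [← sub_eq_zero]
  refine he.eq_zero_of_orthogonal ht ?_ ?_
  · simp [mul_comm]
  · simp [ha, hb, hab, he.symm b a]

lemma mul_lt_sq_of_notMem_span (he : IsOrthonormalFrame g e) {t w : V} (ht : 0 < g t t)
    (hw : w ∉ Submodule.span ℝ {t}) : g w w * g t t < g w t ^ 2 := by
  have hne : g t t • w - g w t • t ≠ 0 := fun h => hw <| by
    rw [← Submodule.smul_mem_iff _ ht.ne', sub_eq_zero.mp h]
    exact Submodule.smul_mem _ _ (Submodule.mem_span_singleton_self t)
  have neg := he.apply_self_neg_of_orthogonal ht (by simp [mul_comm]) hne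
  simp only [map_sub, map_smul, LinearMap.sub_apply, LinearMap.smul_apply, smul_eq_mul,
    he.symm t w] at neg
  nlinarith

lemma exists_apply_add_smul_pos (he : IsOrthonormalFrame g e) (hN : 1 ≤ N) {a b : V}
    (hab : LinearIndependent ℝ ![a, b]) (ha : g a a = 0) (hb : g b b = 0) :
    ∃ s : ℝ, 0 < g (a + s • b) (a + s • b) := by
  obtain ⟨t, ht⟩ := he.exists_apply_self_pos hN
  have hne : g a b ≠ 0 := fun h => by
    have parallel := he.smul_eq_smul_of_null ht ha hb h
    have coeff := LinearIndependent.pair_iff.mp hab (g b t) (-g a t)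
      (by rw [parallel, neg_smul, add_neg_cancel])
    exact hab.ne_zero 1 (he.eq_zero_of_orthogonal ht coeff.1 hb.ge)
  refine ⟨g a b, ?_⟩
  simp only [map_add, map_smul, LinearMap.add_apply, LinearMap.smul_apply, smul_eq_mul, ha, hb,
    he.symm b a]
  nlinarith [mul_self_pos.mpr hne]

lemma mem_span_null (he : IsOrthonormalFrame g e) {W : Submodule ℝ V} {t w : V} (htW : t ∈ W)
    (ht : 0 < g t t) (hwW : w ∈ W) (hw : w ∉ Submodule.span ℝ {t}) :
    t ∈ Submodule.span ℝ {x | x ∈ W ∧ g x x = 0} ∧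
      w ∈ Submodule.span ℝ {x | x ∈ W ∧ g x x = 0} := by
  set S := Submodule.span ℝ {x | x ∈ W ∧ g x x = 0}
  have discrim_pos := he.mul_lt_sq_of_notMem_span ht hw
  set d := √(g w t ^ 2 - g w w * g t t)
  have sq_d : d ^ 2 = g w t ^ 2 - g w w * g t t := Real.sq_sqrt (by linarith)
  have d_pos : 0 < d := Real.sqrt_pos.mpr (by linarith)
  have null_mem {s : ℝ} (hs : s ^ 2 = d ^ 2) : g t t • w + (s - g w t) • t ∈ S := by
    refine Submodule.subset_span ⟨W.add_mem (W.smul_mem _ hwW) (W.smul_mem _ htW), ?_⟩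
    simp only [map_add, map_smul, LinearMap.add_apply, LinearMap.smul_apply, smul_eq_mul,
      he.symm t w]
    linear_combination g t t * hs + g t t * sq_d
  have t_mem : t ∈ S := by
    have := S.sub_mem (null_mem rfl) (null_mem (neg_sq d))
    rwa [show g t t • w + (d - g w t) • t - (g t t • w + (-d - g w t) • t) = (2 * d) • t by
      module, S.smul_mem_iff (mul_pos two_pos d_pos).ne'] at this
  refine ⟨t_mem, ?_⟩
  have := S.sub_mem (null_mem rfl) (S.smul_mem (d - g w t) t_mem)
  rwa [add_sub_cancel_right, S.smul_mem_iff ht.ne'] at this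

lemma span_null_eq (he : IsOrthonormalFrame g e) {W : Submodule ℝ V} {t : V} (htW : t ∈ W)
    (ht : 0 < g t t) (hW : 1 < finrank ℝ W) :
    Submodule.span ℝ {x | x ∈ W ∧ g x x = 0} = W := by
  obtain ⟨w, hwW, hw⟩ : ∃ w ∈ W, w ∉ Submodule.span ℝ {t} := by
    by_contra! h
    exact hW.not_ge ((Submodule.finrank_mono h).trans ((finrank_span_le_card {t}).trans (by simp)))
  have t_mem := (he.mem_span_null htW ht hwW hw).1
  refine le_antisymm (Submodule.span_le.mpr fun x hx => hx.1) fun w hwW => ?_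
  by_cases hw : w ∈ Submodule.span ℝ {t}
  · exact (Submodule.span_singleton_le_iff_mem _ _).mpr t_mem hw
  · exact (he.mem_span_null htW ht hwW hw).2

lemma exists_linearIndependent_span_eq (he : IsOrthonormalFrame g e) {W : Submodule ℝ V} {t : V}
    (htW : t ∈ W) (ht : 0 < g t t) :
    ∃ w : Fin (finrank ℝ W) → V, LinearIndependent ℝ w ∧ Submodule.span ℝ (Set.range w) = W ∧
      (finrank ℝ W = 1 → ∀ i, 0 ≤ g (w i) (w i)) ∧
      (1 < finrank ℝ W → ∀ i, g (w i) (w i) = 0) := by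
  have : FiniteDimensional ℝ V := e.finiteDimensional_of_finite
  have ht0 : t ≠ 0 := by rintro rfl; simp at ht
  rcases Nat.lt_or_ge 1 (finrank ℝ W) with hW | hW
  · have span_null := he.span_null_eq htW ht hW
    have := Submodule.exists_fun_fin_finrank_span_eq ℝ {x | x ∈ W ∧ g x x = 0}
    rw [span_null] at this
    obtain ⟨w, hw, hspan, hli⟩ := this
    exact ⟨w, hli, hspan, fun h => absurd h hW.ne', fun _ i => (hw i).2⟩
  · have span_t : Submodule.span ℝ {t} = W :=
      Submodule.eq_of_le_of_finrank_le (by simpa using htW) (by rwa [finrank_span_singleton ht0])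
    have hfin : finrank ℝ W = 1 := by rw [← span_t, finrank_span_singleton ht0]
    have : Subsingleton (Fin (finrank ℝ W)) := by rw [hfin]; infer_instance
    have : Nonempty (Fin (finrank ℝ W)) := by rw [hfin]; infer_instance
    exact ⟨fun _ => t, .of_subsingleton (Classical.arbitrary _) ht0, by rwa [Set.range_const],
      fun _ _ => ht.le, fun h => absurd hfin h.ne'⟩

end IsOrthonormalFrame

end Causality

section TransverseForms

/-- The `p`-forms which vanish as soon as one of their arguments is `t`, i.e. whose interior product
with `t` is zero. Unlike the equation `Ω.curryLeft t = 0`, the condition makes sense for `p = 0`,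
where it is void. -/
def transverseForms (t : V) (p : ℕ) : Submodule ℝ (V [⋀^Fin p]→ₗ[ℝ] ℝ) where
  carrier := {Ω | ∀ v, t ∈ Set.range v → Ω v = 0}
  add_mem' hΩ hΨ v hv := by simp [hΩ v hv, hΨ v hv]
  zero_mem' _ _ := rfl
  smul_mem' c Ω hΩ v hv := by simp [hΩ v hv]

lemma curryLeft_mem_transverseForms {t : V} {p : ℕ} {Ω : V [⋀^Fin (p + 1)]→ₗ[ℝ] ℝ}
    (hΩ : Ω ∈ transverseForms t (p + 1)) (u : V) : Ω.curryLeft u ∈ transverseForms t p := by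
  rintro v ⟨i, hi⟩
  exact hΩ _ ⟨i.succ, hi⟩

lemma curryLeft_self_mem_transverseForms (t : V) {p : ℕ} (Ω : V [⋀^Fin (p + 1)]→ₗ[ℝ] ℝ) :
    Ω.curryLeft t ∈ transverseForms t p := by
  rintro v ⟨i, hi⟩
  exact Ω.map_eq_zero_of_eq (i := 0) (j := i.succ) _ hi.symm (Fin.succ_ne_zero i).symm

lemma curryLeft_eq_zero_of_mem_transverseForms {t : V} {p : ℕ} {Ω : V [⋀^Fin (p + 1)]→ₗ[ℝ] ℝ}
    (hΩ : Ω ∈ transverseForms t (p + 1)) : Ω.curryLeft t = 0 := by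
  ext v
  exact hΩ _ ⟨0, rfl⟩

lemma eq_zero_of_curryLeft_basis_eq_zero (e : Basis (Fin N) ℝ V) {p : ℕ}
    {Ω : V [⋀^Fin (p + 1)]→ₗ[ℝ] ℝ} (h : ∀ i, Ω.curryLeft (e i) = 0) : Ω = 0 := by
  have curry_eq : Ω.curryLeft = 0 := e.ext h
  ext v
  rw [← Matrix.cons_head_tail v, ← AlternatingMap.curryLeft_apply_apply, curry_eq]
  rfl

lemma superenergy_of_mem_transverseForms (he : IsOrthonormalFrame g e) {p : ℕ} (hp : 1 ≤ p)
    (hpN : p ≤ N) {Ω : V [⋀^Fin p]→ₗ[ℝ] ℝ} {u : V} (hu : Ω ∈ transverseForms u p) (v : V) :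
    superenergy g e Ω u v = -halfSquare e Ω * g u v := by
  rw [superenergy_eq he hp hpN]
  obtain ⟨q, rfl⟩ := Nat.exists_eq_add_of_le' hp
  rw [odot_succ, curryLeft_eq_zero_of_mem_transverseForms hu]
  simp

lemma formInner_self_pos_of_mem_transverseForms (he : IsOrthonormalFrame g e) {t : V}
    (ht : 0 < g t t) {p : ℕ} {Ω : V [⋀^Fin p]→ₗ[ℝ] ℝ} (hΩ : Ω ∈ transverseForms t p) (hΩ0 : Ω ≠ 0) :
    0 < (-1) ^ p * formInner e p Ω Ω := by
  induction p with
  | zero =>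
    have : Ω ![] ≠ 0 := fun h => hΩ0 (by ext v; rwa [Subsingleton.elim v ![]])
    rw [formInner_zero, pow_zero, one_mul]
    exact mul_self_pos.mpr this
  | succ p ih =>
    have contract_t : ∑ i, (sgn i * g t (e i)) • Ω.curryLeft (e i) = 0 := by
      rw [← map_sharp, he.sharp_flat, curryLeft_eq_zero_of_mem_transverseForms hΩ]
    have neg := sum_sgn_mul_apply_self_neg (B := (-1 : ℝ) ^ p • formInner e p)
      (fun Ψ hΨ hΨ0 => ih hΨ hΨ0)
      (by simpa [mul_pow, pow_two (sgn _), sgn_mul_self, he.sum_sgn_mul_sq] using ht)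
      (fun i => curryLeft_mem_transverseForms hΩ (e i)) contract_t
      (fun h => hΩ0 (eq_zero_of_curryLeft_basis_eq_zero e (congrFun h)))
    simp only [LinearMap.smul_apply, smul_eq_mul, mul_left_comm (sgn _), ← Finset.mul_sum,
      ← formInner_succ] at neg
    rw [pow_succ]
    linarith

lemma halfSquare_pos (he : IsOrthonormalFrame g e) {t : V} (ht : 0 < g t t) {p : ℕ} (hp : 1 ≤ p)
    {Ω : V [⋀^Fin p]→ₗ[ℝ] ℝ} (hΩ : Ω ≠ 0) (htΩ : extMul (g t) Ω = 0) : 0 < halfSquare e Ω := by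
  have odot_t := odot_of_extMul_eq_zero he hp htΩ t
  obtain ⟨q, rfl⟩ := Nat.exists_eq_add_of_le' hp
  have contract_ne_zero : Ω.curryLeft t ≠ 0 := fun h => by
    have anticomm := curryLeft_extMul (g t) Ω t
    rw [htΩ, h, map_zero, sub_zero, AlternatingMap.curryLeft_zero] at anticomm
    exact smul_ne_zero ht.ne' hΩ anticomm.symm
  have pos := formInner_self_pos_of_mem_transverseForms he ht
    (curryLeft_self_mem_transverseForms t Ω) contract_ne_zero
  rw [odot_succ, div_mul_eq_mul_div] at odot_t
  have : 0 < 2 * halfSquare e Ω * g t t := odot_t ▸ div_pos pos (by positivity)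
  exact pos_of_mul_pos_right (pos_of_mul_pos_left this ht.le) two_pos.le

end TransverseForms

section SimpleForms

lemma wedge_apply {p : ℕ} (ω : Fin p → Dual ℝ V) (v : Fin p → V) :
    wedge ω v = (Matrix.of fun i j => ω j (v i)).det :=
  rfl

lemma wedge_smul {p : ℕ} (c : ℝ) (ω : Fin p → Dual ℝ V) : wedge (c • ω) = c ^ p • wedge ω := by
  ext v
  exact ((Matrix.of fun i j => ω j (v i)).det_smul c).trans (by rw [Fintype.card_fin]; rfl)

lemma extMul_wedge {p : ℕ} (α : Dual ℝ V) (ω : Fin p → Dual ℝ V) :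
    extMul α (wedge ω) = wedge (Fin.cons α ω) := by
  ext v
  rw [wedge_apply, Matrix.det_succ_column_zero, extMul_apply]
  simp only [zsmul_eq_mul, smul_eq_mul, mul_assoc]
  push_cast
  rfl

lemma extMul_wedge_eq_zero {p : ℕ} {α : Dual ℝ V} {ω : Fin p → Dual ℝ V}
    (hα : α ∈ Submodule.span ℝ (Set.range ω)) : extMul α (wedge ω) = 0 := by
  suffices Submodule.span ℝ (Set.range ω) ≤ LinearMap.ker (extMul.flip (wedge ω)) from this hα
  rw [Submodule.span_le]
  rintro _ ⟨j, rfl⟩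
  change extMul (ω j) (wedge ω) = 0
  rw [extMul_wedge]
  ext v
  exact Matrix.det_zero_of_column_eq (Fin.succ_ne_zero j).symm fun _ => rfl

lemma wedge_mem_transverseForms {p : ℕ} {ω : Fin p → Dual ℝ V} {u : V} (hu : ∀ j, ω j u = 0) :
    wedge ω ∈ transverseForms u p := by
  rintro v ⟨i, rfl⟩
  exact Matrix.det_eq_zero_of_row_eq_zero i hu

lemma wedge_ne_zero {p : ℕ} {ω : Fin p → Dual ℝ V} (hω : LinearIndependent ℝ ω) :
    wedge ω ≠ 0 := by
  have surjective : LinearMap.range (LinearMap.pi ω) = ⊤ := by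
    by_contra hne
    obtain ⟨f, hf, hker⟩ := Submodule.exists_le_ker_of_lt_top _ (lt_top_iff_ne_top.mpr hne)
    have relation : ∑ j, f (Pi.single j 1) • ω j = 0 := by
      ext v
      have := hker (LinearMap.mem_range_self _ v)
      rw [LinearMap.mem_ker, pi_eq_sum_univ' (LinearMap.pi ω v), map_sum] at this
      simpa [mul_comm, ← Pi.single_apply] using this
    refine hf (LinearMap.pi_ext' fun j => LinearMap.ext_ring ?_)
    exact Fintype.linearIndependent_iff.mp hω _ relation j
  choose v hv using fun i : Fin p =>
    LinearMap.range_eq_top.mp surjective (Pi.single i (1 : ℝ))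
  intro h
  have det_eq : wedge ω v = 1 := by
    rw [wedge_apply, ← Matrix.det_one (n := Fin p)]
    congr 1
    ext i j
    simpa [Matrix.one_apply, Pi.single_apply, eq_comm] using congrFun (hv i) j
  simp [h] at det_eq

lemma wedge_one_apply (ω : Fin 1 → Dual ℝ V) (u : V) : wedge ω ![u] = ω 0 u := by
  simp [wedge_apply]

lemma halfSquare_wedge_one (ω : Fin 1 → Dual ℝ V) :
    halfSquare e (wedge ω) = 1 / 2 * dot e (ω 0) (ω 0) := by
  simp [halfSquare, formInner_succ, formInner_zero, wedge_one_apply, dot, mul_assoc]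

lemma odot_wedge_one (ω : Fin 1 → Dual ℝ V) (u v : V) :
    odot e (wedge ω) u v = ω 0 u * ω 0 v := by
  simp [odot_succ, formInner_zero, wedge_one_apply]

end SimpleForms

section CausalForms

lemma dot_smul_smul (c : ℝ) (α : Dual ℝ V) : dot e (c • α) (c • α) = c ^ 2 * dot e α α := by
  simp only [← apply_sharp, map_smul, LinearMap.smul_apply, smul_eq_mul]
  ring

lemma isCausalSimple_wedge_flat (he : IsOrthonormalFrame g e) {p : ℕ} {w : Fin p → V}
    (hw : LinearIndependent ℝ w) (hw_causal : p = 1 → ∀ i, 0 ≤ g (w i) (w i))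
    (hw_null : 1 < p → ∀ i, g (w i) (w i) = 0) : IsCausalSimple e (wedge fun j => g (w j)) := by
  have ker_flat : LinearMap.ker g = ⊥ :=
    LinearMap.ker_eq_bot'.mpr fun x hx => he.eq_zero fun y => by rw [hx, LinearMap.zero_apply]
  have hli : LinearIndependent ℝ fun j => g (w j) := hw.map' g ker_flat
  exact ⟨_, hli, rfl, fun hp i => (he.dot_flat _ _).symm ▸ hw_causal hp i,
    fun hp i => ⟨hli.ne_zero i, (he.dot_flat _ _).trans (hw_null hp i)⟩⟩

namespace IsCausalSimple

variable {p : ℕ} {Ω : V [⋀^Fin p]→ₗ[ℝ] ℝ}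

lemma isSimple (hΩ : IsCausalSimple e Ω) : IsSimple Ω := by
  obtain ⟨ω, hω, rfl, -⟩ := hΩ
  exact ⟨ω, hω, rfl⟩

lemma smul (hΩ : IsCausalSimple e Ω) (hp : 1 ≤ p) {a : ℝ} (ha : 0 < a) :
    IsCausalSimple e (a • Ω) := by
  obtain ⟨ω, hω, rfl, hcausal, hnull⟩ := hΩ
  set c := a ^ (p : ℝ)⁻¹
  have hc : 0 < c := Real.rpow_pos_of_pos ha _
  have hcp : c ^ p = a := Real.rpow_inv_natCast_pow ha.le (by omega)
  have hcω : LinearIndependent ℝ (c • ω) := hω.units_smul fun _ => Units.mk0 c hc.ne'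
  refine ⟨c • ω, hcω, by rw [wedge_smul, hcp], fun hp i => ?_,
    fun hp i => ⟨hcω.ne_zero i, ?_⟩⟩
  · rw [Pi.smul_apply, dot_smul_smul]
    exact mul_nonneg (sq_nonneg c) (hcausal hp i)
  · rw [Pi.smul_apply, dot_smul_smul, (hnull hp i).2, mul_zero]

lemma halfSquare_nonneg (he : IsOrthonormalFrame g e) (hN : 1 ≤ N) (hp : 1 ≤ p)
    (hΩ : IsCausalSimple e Ω) : 0 ≤ halfSquare e Ω := by
  obtain ⟨ω, hω, rfl, hcausal, hnull⟩ := hΩ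
  rcases hp.eq_or_lt with rfl | hp
  · rw [halfSquare_wedge_one]
    exact mul_nonneg one_half_pos.le (hcausal rfl 0)
  let a : Fin p := ⟨0, by omega⟩
  let b : Fin p := ⟨1, hp⟩
  have independent : LinearIndependent ℝ ![sharp e (ω a), sharp e (ω b)] := by
    have hab : Function.Injective ![a, b] := by
      simp [Function.Injective, Fin.forall_fin_two, a, b]
    convert! (hω.map' (sharp e) (LinearMap.ker_eq_bot.mpr he.sharp_injective)).comp _ hab using 1
    ext i
    fin_cases i <;> rfl
  have null (i : Fin p) : g (sharp e (ω i)) (sharp e (ω i)) = 0 :=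
    (he.apply_sharp_sharp _ _).trans (hnull hp i).2
  obtain ⟨s, timelike⟩ := he.exists_apply_add_smul_pos hN independent (null a) (null b)
  refine (halfSquare_pos he timelike hp.le (wedge_ne_zero hω) (extMul_wedge_eq_zero ?_)).le
  rw [map_add, map_smul, he.flat_sharp, he.flat_sharp]
  exact Submodule.add_mem _ (Submodule.subset_span ⟨a, rfl⟩)
    (Submodule.smul_mem _ _ (Submodule.subset_span ⟨b, rfl⟩))

end IsCausalSimple

lemma exists_isCausalSimple_superenergy_eq (he : IsOrthonormalFrame g e) {W : Submodule ℝ V}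
    {t : V} (htW : t ∈ W) (ht : 0 < g t t) {r : ℝ} (hr : 0 < r) :
    ∃ p, 1 ≤ p ∧ p ≤ N ∧ ∃ Ω : V [⋀^Fin p]→ₗ[ℝ] ℝ, IsCausalSimple e Ω ∧ halfSquare e Ω = r ∧
      (∀ u ∈ W, ∀ v, superenergy g e Ω u v = r * g u v) ∧
      ∀ u, (∀ w ∈ W, g w u = 0) → ∀ v, superenergy g e Ω u v = -r * g u v := by
  have : FiniteDimensional ℝ V := e.finiteDimensional_of_finite
  have W_ne_bot : W ≠ ⊥ := (Submodule.ne_bot_iff W).mpr ⟨t, htW, by rintro rfl; simp at ht⟩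
  have hp : 1 ≤ finrank ℝ W := Submodule.one_le_finrank_iff.mpr W_ne_bot
  have hpN : finrank ℝ W ≤ N := by
    simpa [finrank_eq_card_basis e] using Submodule.finrank_le W
  obtain ⟨w, hw, span_w, hcausal, hnull⟩ := he.exists_linearIndependent_span_eq htW ht
  set Ω := wedge fun j => g (w j)
  have hΩ : IsCausalSimple e Ω := isCausalSimple_wedge_flat he hw hcausal hnull
  have extMul_eq_zero {u : V} (hu : u ∈ W) : extMul (g u) Ω = 0 := by
    refine extMul_wedge_eq_zero ?_
    rw [← span_w] at hu
    have := Submodule.mem_map_of_mem (f := g) hu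
    rwa [Submodule.map_span, ← Set.range_comp] at this
  have hΩ0 : 0 < halfSquare e Ω := by
    obtain ⟨ω, hω, hΩω⟩ := hΩ.isSimple
    exact halfSquare_pos he ht hp (hΩω ▸ wedge_ne_zero hω) (extMul_eq_zero htW)
  set a := √(r / halfSquare e Ω)
  have ha : 0 < a := Real.sqrt_pos.mpr (div_pos hr hΩ0)
  have halfSquare_eq : halfSquare e (a • Ω) = r := by
    rw [halfSquare_smul, Real.sq_sqrt (div_pos hr hΩ0).le, div_mul_cancel₀ _ hΩ0.ne']
  refine ⟨_, hp, hpN, a • Ω, hΩ.smul hp ha, halfSquare_eq, fun u hu v => ?_, fun u hu v => ?_⟩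
  · rw [superenergy_of_extMul_eq_zero he hp hpN (by rw [map_smul, extMul_eq_zero hu, smul_zero]),
      halfSquare_eq]
  · have w_mem (j) : w j ∈ W := span_w ▸ Submodule.subset_span ⟨j, rfl⟩
    rw [superenergy_of_mem_transverseForms he hp hpN
      (Submodule.smul_mem _ a (wedge_mem_transverseForms fun j => hu _ (w_mem j))), halfSquare_eq]

end CausalForms

section Classification

/-- The endomorphism `u^a ↦ T_a^b u^a` obtained by raising the second index of a tensor. -/
noncomputable def raise (e : Basis (Fin N) ℝ V) (T : LinearMap.BilinForm ℝ V) : V →ₗ[ℝ] V :=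
  sharp e ∘ₗ T

variable {T : LinearMap.BilinForm ℝ V}

lemma IsOrthonormalFrame.flat_raise (he : IsOrthonormalFrame g e) (u : V) :
    g (raise e T u) = T u :=
  he.flat_sharp (T u)

lemma apply_raise (u v : V) : T v (raise e T u) = cross e T T u v :=
  apply_sharp (T u) (T v)

lemma IsOrthonormalFrame.apply_raise_raise (he : IsOrthonormalFrame g e) (u v : V) :
    g (raise e T u) (raise e T v) = cross e T T u v := by
  rw [he.symm, he.flat_raise, apply_raise]

lemma raise_raise (he : IsOrthonormalFrame g e) (hT : ∀ u v, T u v = T v u) {f : ℝ}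
    (hTT : ∀ u v, cross e T T u v = f * g u v) (u : V) : raise e T (raise e T u) = f • u := by
  rw [← sub_eq_zero]
  refine he.eq_zero fun v => ?_
  rw [map_sub, LinearMap.sub_apply, he.flat_raise, hT, apply_raise, hTT]
  simp

lemma raise_smul_add_raise (he : IsOrthonormalFrame g e) (hT : ∀ u v, T u v = T v u) {r : ℝ}
    (hTT : ∀ u v, cross e T T u v = r ^ 2 * g u v) (u : V) :
    raise e T (r • u + raise e T u) = r • (r • u + raise e T u) := by
  rw [map_add, map_smul, raise_raise he hT hTT, smul_add, smul_smul, sq, add_comm]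

lemma exists_raise_eq_smul_add (he : IsOrthonormalFrame g e) (hT : ∀ u v, T u v = T v u) {r : ℝ}
    (hr : r ≠ 0) (hTT : ∀ u v, cross e T T u v = r ^ 2 * g u v) (u : V) :
    ∃ x y, raise e T x = r • x ∧ raise e T y = -r • y ∧ x + y = u := by
  refine ⟨(2 * r)⁻¹ • (r • u + raise e T u), -(2 * r)⁻¹ • (-r • u + raise e T u), ?_, ?_, ?_⟩
  · rw [map_smul, raise_smul_add_raise he hT hTT, smul_comm]
  · rw [map_smul, raise_smul_add_raise he hT (by simpa only [neg_sq] using hTT), smul_comm]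
  · match_scalars
    · field_simp
      norm_num
    · ring

lemma apply_of_raise_eq_smul (he : IsOrthonormalFrame g e) {r : ℝ} {u : V}
    (hu : raise e T u = r • u) (v : V) : T u v = r * g u v := by
  rw [← he.flat_raise, hu, map_smul, LinearMap.smul_apply, smul_eq_mul]

lemma apply_eq_zero_of_raise_eq_smul (he : IsOrthonormalFrame g e) (hT : ∀ u v, T u v = T v u)
    {r s : ℝ} (hrs : r ≠ s) {u v : V} (hu : raise e T u = r • u) (hv : raise e T v = s • v) :
    g u v = 0 := by
  refine (mul_eq_mul_right_iff.mp ?_).resolve_left hrs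
  rw [← apply_of_raise_eq_smul he hu, hT, apply_of_raise_eq_smul he hv, he.symm]

lemma nonneg_of_cross_eq (he : IsOrthonormalFrame g e) (hN : 3 ≤ N) {f : ℝ}
    (hTT : ∀ u v, cross e T T u v = f * g u v) : 0 ≤ f := by
  by_contra! hf
  let a : Fin N := ⟨1, by omega⟩
  let b : Fin N := ⟨2, by omega⟩
  have haa : g (e a) (e a) = -1 := by simp [a, he _ _, sgn]
  have hbb : g (e b) (e b) = -1 := by simp [b, he _ _, sgn]
  have hba : g (e b) (e a) = 0 := by simp [a, b, he _ _]
  have neg := he.apply_self_neg_of_orthogonal (t := raise e T (e a)) (x := raise e T (e b))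
    (by rw [he.apply_raise_raise, hTT, haa]; linarith)
    (by rw [he.apply_raise_raise, hTT, hba, mul_zero])
    (fun h => by
      have := he.apply_raise_raise (T := T) (e b) (e b)
      rw [h, hTT, hbb, map_zero] at this
      linarith)
  rw [he.apply_raise_raise, hTT, hbb] at neg
  linarith

lemma apply_self_ne_zero_of_cross_eq_zero (he : IsOrthonormalFrame g e)
    (hT : ∀ u v, T u v = T v u) (hTT : ∀ u v, cross e T T u v = 0) {t : V} (ht : 0 < g t t)
    (hT0 : T ≠ 0) : T t t ≠ 0 := by
  have eq_zero {u : V} (hu : T u t = 0) : T u = 0 := by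
    have raise_eq_zero : raise e T u = 0 := he.eq_zero_of_orthogonal ht
      (by rw [he.flat_raise, hu]) (by rw [he.apply_raise_raise, hTT])
    rw [← he.flat_raise, raise_eq_zero, map_zero]
  intro htt
  exact hT0 (LinearMap.ext fun u => eq_zero (by rw [hT, eq_zero htt, LinearMap.zero_apply]))

lemma apply_self_mul_apply_of_cross_eq_zero (he : IsOrthonormalFrame g e)
    (hT : ∀ u v, T u v = T v u) (hTT : ∀ u v, cross e T T u v = 0) {t : V} (ht : 0 < g t t)
    (u v : V) : T t t * T u v = T t u * T t v := by
  have null (x y : V) : g (raise e T x) (raise e T y) = 0 := by rw [he.apply_raise_raise, hTT]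
  have parallel := he.smul_eq_smul_of_null ht (null t t) (null u u) (null t u)
  have := congrArg (fun x => g x v) parallel
  simp only [map_smul, LinearMap.smul_apply, he.flat_raise, smul_eq_mul] at this
  rw [← this, hT u t]

lemma exists_isNull (he : IsOrthonormalFrame g e) (hN : 2 ≤ N) : ∃ k, IsNull e k := by
  let a : Fin N := ⟨0, by omega⟩
  let b : Fin N := ⟨1, by omega⟩
  refine ⟨g (e a + e b), fun h => ?_, ?_⟩
  · simpa [a, b, he _ _, sgn] using congrArg (fun α => α (e a)) h
  · rw [he.dot_flat]
    simp [a, b, he _ _, sgn]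

lemma exists_isNull_eq_mul (he : IsOrthonormalFrame g e) (hN : 2 ≤ N)
    (hT : ∀ u v, T u v = T v u) (hTT : ∀ u v, cross e T T u v = 0) :
    ∃ (β : ℝ) (k : Dual ℝ V), IsNull e k ∧ ∀ u v, T u v = β * (k u * k v) := by
  rcases eq_or_ne T 0 with rfl | hT0
  · obtain ⟨k, hk⟩ := exists_isNull he hN
    exact ⟨0, k, hk, by simp⟩
  obtain ⟨t, ht⟩ := he.exists_apply_self_pos (by omega)
  have htt := apply_self_ne_zero_of_cross_eq_zero he hT hTT ht hT0
  refine ⟨(T t t)⁻¹, T t, ⟨fun h => htt (by rw [h, LinearMap.zero_apply]), hTT t t⟩,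
    fun u v => ?_⟩
  rw [← apply_self_mul_apply_of_cross_eq_zero he hT hTT ht, inv_mul_cancel_left₀ htt]

lemma mem_NS_of_isNull (he : IsOrthonormalFrame g e) (hN : 1 ≤ N) {k : Dual ℝ V}
    (hk : IsNull e k) {β : ℝ} (hβ : 0 < β) (hT : ∀ u v, T u v = β * (k u * k v)) :
    T ∈ NS g e := by
  have hdot : dot e (√β • k) (√β • k) = 0 := by rw [dot_smul_smul, hk.2, mul_zero]
  have hsq : halfSquare e (wedge fun _ : Fin 1 => √β • k) = 0 := by
    rw [halfSquare_wedge_one, hdot, mul_zero]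
  refine ⟨1, le_rfl, hN, _, ⟨⟨fun _ => √β • k, LinearIndependent.of_subsingleton 0
    (smul_ne_zero (Real.sqrt_pos.mpr hβ).ne' hk.1), rfl⟩, ?_⟩, fun u v => ?_⟩
  · simpa [halfSquare, formInner_apply] using hsq
  · rw [superenergy_eq he le_rfl hN, hsq, odot_wedge_one, hT, LinearMap.smul_apply,
      LinearMap.smul_apply, smul_eq_mul, smul_eq_mul]
    linear_combination -(k u * k v) * Real.mul_self_sqrt hβ.le

lemma exists_superenergy_eq_of_cross_eq (he : IsOrthonormalFrame g e) (hT : ∀ u v, T u v = T v u)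
    {r : ℝ} (hr : 0 < r) (hTT : ∀ u v, cross e T T u v = r ^ 2 * g u v) {t : V} (ht : 0 < g t t)
    (hTt : 0 ≤ T t t) :
    ∃ p, 1 ≤ p ∧ p ≤ N ∧ ∃ Ω : V [⋀^Fin p]→ₗ[ℝ] ℝ, IsCausalSimple e Ω ∧ halfSquare e Ω = r ∧
      ∀ u v, T u v = superenergy g e Ω u v := by
  set W := Module.End.eigenspace (raise e T) r
  have projection_mem : r • t + raise e T t ∈ W :=
    Module.End.mem_eigenspace_iff.mpr (raise_smul_add_raise he hT hTT t)
  have timelike : 0 < g (r • t + raise e T t) (r • t + raise e T t) := by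
    have : g (r • t + raise e T t) (r • t + raise e T t) = 2 * r * (r * g t t + T t t) := by
      simp only [map_add, map_smul, LinearMap.add_apply, LinearMap.smul_apply, smul_eq_mul,
        he.flat_raise, apply_raise, hTT, he.symm t (raise e T t)]
      ring
    rw [this]
    positivity
  obtain ⟨p, hp, hpN, Ω, hΩ, hsq, on_W, on_orthogonal⟩ :=
    exists_isCausalSimple_superenergy_eq he projection_mem timelike hr
  refine ⟨p, hp, hpN, Ω, hΩ, hsq, fun u v => ?_⟩
  obtain ⟨x, y, hx, hy, rfl⟩ := exists_raise_eq_smul_add he hT hr.ne' hTT u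
  rw [map_add, LinearMap.add_apply, superenergy_add_left he hp hpN,
    on_W x (Module.End.mem_eigenspace_iff.mpr hx),
    on_orthogonal y fun w hw => apply_eq_zero_of_raise_eq_smul he hT (by linarith)
      (Module.End.mem_eigenspace_iff.mp hw) hy,
    apply_of_raise_eq_smul he hx, apply_of_raise_eq_smul he hy]

lemma sq_halfSquare_of_cross_eq (he : IsOrthonormalFrame g e) {p : ℕ} (hp : 1 ≤ p) (hpN : p ≤ N)
    {Ω : V [⋀^Fin p]→ₗ[ℝ] ℝ} (hΩ : IsSimple Ω) (hTΩ : ∀ u v, T u v = superenergy g e Ω u v) {f : ℝ}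
    (hTT : ∀ u v, cross e T T u v = f * g u v) : halfSquare e Ω ^ 2 = f := by
  obtain ⟨ω, hω, rfl⟩ := hΩ
  set u := sharp e (ω ⟨0, hp⟩)
  have flat_u : g u = ω ⟨0, hp⟩ := he.flat_sharp _
  obtain ⟨v, hv⟩ : ∃ v, g u v ≠ 0 := by
    by_contra! h
    exact hω.ne_zero ⟨0, hp⟩ (flat_u.symm.trans (LinearMap.ext h))
  have eigen : T u = halfSquare e (wedge ω) • g u := by
    ext x
    rw [hTΩ, superenergy_of_extMul_eq_zero he hp hpN (extMul_wedge_eq_zero _)]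
    · rfl
    · exact flat_u ▸ Submodule.subset_span ⟨_, rfl⟩
  refine mul_right_cancel₀ hv ?_
  rw [← hTT, ← apply_raise, raise, LinearMap.comp_apply, eigen, map_smul, he.sharp_flat, map_smul,
    hTΩ v, superenergy_comm he hp hpN, ← hTΩ, eigen, LinearMap.smul_apply, smul_smul, sq]
  rfl

lemma mem_NS_or_neg_mem_NS (he : IsOrthonormalFrame g e) (hN : 1 ≤ N) {k : Dual ℝ V}
    (hk : IsNull e k) {β : ℝ} (hT : ∀ u v, T u v = β * (k u * k v)) (hT0 : T ≠ 0) :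
    T ∈ NS g e ∨ -T ∈ NS g e := by
  rcases lt_trichotomy β 0 with hβ | rfl | hβ
  · refine .inr (mem_NS_of_isNull he hN hk (neg_pos.mpr hβ) fun u v => ?_)
    rw [LinearMap.neg_apply, LinearMap.neg_apply, hT, neg_mul]
  · exact absurd (LinearMap.ext₂ fun u v => by rw [hT, zero_mul]; rfl) hT0
  · exact .inl (mem_NS_of_isNull he hN hk hβ hT)

lemma metricTrace_eq_of_superenergy_eq (he : IsOrthonormalFrame g e) {p : ℕ} (hp : 1 ≤ p)
    (hpN : p ≤ N) {Ω : V [⋀^Fin p]→ₗ[ℝ] ℝ} (hTΩ : ∀ u v, T u v = superenergy g e Ω u v) :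
    metricTrace e T = (2 * p - N) * halfSquare e Ω := by
  simp only [metricTrace, hTΩ, sum_sgn_mul_superenergy he hp hpN]

lemma metricTrace_smul (c : ℝ) : metricTrace e (c • T) = c * metricTrace e T := by
  simp only [metricTrace, Finset.mul_sum, LinearMap.smul_apply, smul_eq_mul, mul_left_comm]

lemma cross_smul_smul (c : ℝ) (u v : V) :
    cross e (c • T) (c • T) u v = c ^ 2 * cross e T T u v := by
  simp only [cross, Finset.mul_sum, LinearMap.smul_apply, smul_eq_mul]
  exact Finset.sum_congr rfl fun i _ => by ring

lemma cross_sign_smul {ε : ℝ} (hε : ε = 1 ∨ ε = -1) (u v : V) :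
    cross e (ε • T) (ε • T) u v = cross e T T u v := by
  rw [cross_smul_smul, sq_eq_one_iff.mpr hε, one_mul]

lemma exists_sign_mul_eq_superenergy (he : IsOrthonormalFrame g e) (hN : 1 ≤ N)
    (hT : ∀ u v, T u v = T v u) {r : ℝ} (hr : 0 < r)
    (hTT : ∀ u v, cross e T T u v = r ^ 2 * g u v) :
    ∃ ε : ℝ, (ε = 1 ∨ ε = -1) ∧ ∃ p, 1 ≤ p ∧ p ≤ N ∧ ∃ Ω : V [⋀^Fin p]→ₗ[ℝ] ℝ,
      IsCausalSimple e Ω ∧ halfSquare e Ω = r ∧ ∀ u v, ε * T u v = superenergy g e Ω u v := by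
  obtain ⟨t, ht⟩ := he.exists_apply_self_pos hN
  obtain ⟨ε, hε, hεT⟩ : ∃ ε : ℝ, (ε = 1 ∨ ε = -1) ∧ 0 ≤ ε * T t t := by
    rcases le_total 0 (T t t) with h | h
    · exact ⟨1, .inl rfl, by linarith⟩
    · exact ⟨-1, .inr rfl, by linarith⟩
  exact ⟨ε, hε, exists_superenergy_eq_of_cross_eq (T := ε • T) he
    (fun u v => congrArg (ε * ·) (hT u v)) hr (fun u v => by rw [cross_sign_smul hε, hTT]) ht hεT⟩

end Classification

end SuperEnergy

theorem mainTheorem1 {V : Type*} [AddCommGroup V] [Module ℝ V] {N : ℕ} (hN : 2 ≤ N)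
    (g : LinearMap.BilinForm ℝ V) (e : Module.Basis (Fin N) ℝ V)
    (he : SuperEnergy.IsOrthonormalFrame g e)
    (T : LinearMap.BilinForm ℝ V) (hT : ∀ u v, T u v = T v u) (f : ℝ)
    (hTT : ∀ u v, SuperEnergy.cross e T T u v = f * g u v)
    (hf : N = 2 → 0 ≤ f) :
    (f = 0 →
      (∃ (β : ℝ) (k : Module.Dual ℝ V), SuperEnergy.IsNull e k ∧ ∀ u v, T u v = β * (k u * k v)) ∧
      (T ≠ 0 → T ∈ SuperEnergy.NS g e ∨ -T ∈ SuperEnergy.NS g e)) ∧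
    (f ≠ 0 →
      0 < f ∧
      ∃ ε : ℝ, (ε = 1 ∨ ε = -1) ∧
        ε • T ∈ SuperEnergy.SS g e ∧
        (∃ p : ℕ, 1 ≤ p ∧ p ≤ N ∧
          ε * SuperEnergy.metricTrace e T = (2 * (p : ℝ) - (N : ℝ)) * √f) ∧
        ∀ p : ℕ, 1 ≤ p → p ≤ N →
          (ε * SuperEnergy.metricTrace e T = (2 * (p : ℝ) - (N : ℝ)) * √f ↔
            ∃ Ω : V [⋀^Fin p]→ₗ[ℝ] ℝ, SuperEnergy.IsCausalSimple e Ω ∧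
              ∀ u v, ε * T u v = SuperEnergy.superenergy g e Ω u v)) := by
  open SuperEnergy in
  refine ⟨fun hf0 => ?_, fun hf0 => ?_⟩
  · obtain ⟨β, k, hk, hTk⟩ := exists_isNull_eq_mul he hN hT fun u v => by rw [hTT, hf0, zero_mul]
    exact ⟨⟨β, k, hk, hTk⟩, mem_NS_or_neg_mem_NS he (by omega) hk hTk⟩
  · have hf_nonneg : 0 ≤ f :=
      hN.eq_or_lt.elim (fun h => hf h.symm) fun h => nonneg_of_cross_eq he h hTT
    have hf_pos : 0 < f := hf_nonneg.lt_of_ne' hf0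
    have hr : 0 < √f := Real.sqrt_pos.mpr hf_pos
    obtain ⟨ε, hε, p, hp, hpN, Ω, hΩ, hsq, hTΩ⟩ :=
      exists_sign_mul_eq_superenergy he (by omega) hT hr (by rwa [Real.sq_sqrt hf_nonneg])
    have trace_eq : ε * metricTrace e T = (2 * p - N) * √f := by
      rw [← metricTrace_smul, metricTrace_eq_of_superenergy_eq he hp hpN hTΩ, hsq]
    refine ⟨hf_pos, ε, hε, ⟨p, hp, hpN, Ω, hΩ.isSimple, hTΩ⟩, ⟨p, hp, hpN, trace_eq⟩,
      fun q hq hqN => ⟨fun h => ?_, fun ⟨Ω', hΩ', hTΩ'⟩ => ?_⟩⟩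
    · obtain rfl : p = q := by
        have := mul_right_cancel₀ hr.ne' (trace_eq.symm.trans h)
        exact_mod_cast (by linarith : (p : ℝ) = q)
      exact ⟨Ω, hΩ, hTΩ⟩
    · have hsq' : halfSquare e Ω' ^ 2 = f := sq_halfSquare_of_cross_eq he hq hqN hΩ'.isSimple hTΩ'
        fun u v => by rw [cross_sign_smul hε, hTT]
      rw [← metricTrace_smul, metricTrace_eq_of_superenergy_eq he hq hqN hTΩ', ← hsq',
        Real.sqrt_sq (hΩ'.halfSquare_nonneg he (by omega) hq)]
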